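/- A set $S$ of integers is called a $B^*[g]$ set if for every integer $m$ there are at most $g$ ordered pairs $(s_1,s_2)\in S\times S$ with $s_1+s_2=m$. For positive integers $g,n$ let $R(g,n)$ be the largest size of a $B^*[g]$ set contained in $\{1,2,\dots,n\}$, and let $$\overline{\rho}(g)=\limsup_{n\to\infty}\frac{R(g,n)}{\sqrt{gn}}.$$ **Theorem.** For all positive integers $g$ and $n$, $$R(g,n)\le 1.30036\,\sqrt{gn},$$ and if $g\ge 3$ is odd, then for all positive integers $n$ $$R(g,n)\le 1.31925\,\sqrt{(g-1)n}+\tfrac13 .$$ Moreover, for every integer $g\ge2$, $$\overline{\rho}(g)^2\le \begin{cases} 1.74043-\dfrac{1.00483}{g}, & g\le 8 \text{ and } g \text{ even};\\[2mm] 1.58337-\dfrac{0.026335}{g}+\sqrt{0.011572-\dfrac{0.083397}{g}+\dfrac{0.00069356}{g^2}}, & g\ge 10 \text{ and } g \text{ even};\\[2mm] 1.74043-\dfrac{2.74525}{g}, & g\le 23 \text{ and } g \text{ odd};\\[2mm] 1.58337-\dfrac{0.071949}{g}+\sqrt{0.011572-\dfrac{0.22784}{g}+\dfrac{0.0051768}{g^2}},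 & g\ge 25 \text{ and } g \text{ odd}. \end{cases}$$ -/

import Mathlib

namespace BStar

/-- A set `S` of integers is a `B*[g]` set if every integer `m` is a sum `s₁ + s₂` for at most `g`
ordered pairs `(s₁, s₂)` in `S × S`. -/
def IsBStar (g : ℕ) (S : Set ℤ) : Prop :=
  ∀ m : ℤ, {p : ℤ × ℤ | p.1 ∈ S ∧ p.2 ∈ S ∧ p.1 + p.2 = m}.encard ≤ (g : ℕ∞)

open Classical in
/-- `R g n` is the largest size of a `B*[g]` set contained in `{1, …, n}`. (The family over which
the maximum is taken is finite and contains the empty set.) -/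
noncomputable def R (g n : ℕ) : ℕ :=
  ((Finset.Icc (1 : ℤ) (n : ℤ)).powerset.filter
    fun S : Finset ℤ => IsBStar g (S : Set ℤ)).sup Finset.card

/-- The upper limit of `R g n / √(g n)` as `n → ∞`. (The quotients lie between `0` and `√2`, so
this is a genuine real upper limit.) -/
noncomputable def rhoBar (g : ℕ) : ℝ :=
  Filter.limsup (fun n : ℕ => (R g n : ℝ) / √((g : ℝ) * (n : ℝ))) Filter.atTop

end BStar

namespace BStar

/-! Let `N = #S`, and let `r`, `d` count representations as sums and as differences. The additive
energy is both `∑ r ^ 2` and `∑ d ^ 2`. The `B*[g]` condition bounds it by `g * N ^ 2`, or by `(g -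
1) * N ^ 2 + g * N` for odd `g`. For a lower bound, `d` is compared with a constant plus a
triangular kernel, `a + b * tri L`. The sum of `(d - a - b * tri L) ^ 2` is at least its term at
`0`, where `d 0 = N`. Expanding requires a lower bound for `∑ d * tri L`. This comes from Cauchy's
inequality for window counts of `S` plus their reflections, since the cross terms are `∑ r * tri L`,
at most `g * L ^ 2` (`sq_le_sum_tri`, `sum_tri_sum_le`). The result is `sq_add_le_energy`. With `L ≈
n / 5` it gives `N ^ 2 ≤ (105 / 64) * g * n`, and `105 / 64 = 1.640625` leaves room below every
stated constant. The term at `0` supplies a further saving in the upper limit. -/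

open Finset

/-! ### Representation counts and the triangular kernel. -/

/-- The number of ordered pairs in `S × S` with sum `m`. -/
def sumCount (S : Finset ℤ) (m : ℤ) : ℕ := #{p ∈ S ×ˢ S | p.1 + p.2 = m}

/-- The number of ordered pairs in `S × S` with difference `k`. -/
def diffCount (S : Finset ℤ) (k : ℤ) : ℕ := #{p ∈ S ×ˢ S | p.1 - p.2 = k}

/-- The triangular kernel of half-width `L`. -/
def tri (L : ℕ) (k : ℤ) : ℝ := ((L - k.natAbs : ℕ) : ℝ)

lemma tri_nonneg (L : ℕ) (k : ℤ) : 0 ≤ tri L k := Nat.cast_nonneg _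

lemma tri_zero (L : ℕ) : tri L 0 = L := by simp [tri]

lemma sum_Ioo_natAbs (φ : ℕ → ℝ) (M : ℕ) :
    ∑ k ∈ Ioo (-((M : ℤ) + 1)) ((M : ℤ) + 1), φ k.natAbs
      = 2 * ∑ j ∈ range (M + 1), φ j - φ 0 := by
  induction M with
  | zero =>
    have : Ioo (-(((0 : ℕ) : ℤ) + 1)) (((0 : ℕ) : ℤ) + 1) = {0} := by
      ext x; simp only [mem_Ioo, mem_singleton]; omega
    rw [this]; simp; ring
  | succ M ih =>
    have : Ioo (-(((M + 1 : ℕ) : ℤ) + 1)) (((M + 1 : ℕ) : ℤ) + 1)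
        = insert ((M : ℤ) + 1) (insert (-((M : ℤ) + 1)) (Ioo (-((M : ℤ) + 1)) ((M : ℤ) + 1))) := by
      ext x; simp only [mem_Ioo, mem_insert]; omega
    have h1 : ((M : ℤ) + 1).natAbs = M + 1 := by omega
    have h2 : (-((M : ℤ) + 1)).natAbs = M + 1 := by omega
    rw [this, sum_insert, sum_insert, ih, sum_range_succ _ (M + 1), h1, h2]
    · ring
    · simp
    · simp only [mem_insert, mem_Ioo]; omega

lemma sum_range_tsub (φ : ℕ → ℝ) (hφ : φ 0 = 0) {L M : ℕ} (h : L ≤ M) :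
    ∑ j ∈ range M, φ (L - j) = ∑ j ∈ range L, φ (j + 1) := by
  rw [← sum_range_reflect (fun j => φ (j + 1)) L]
  symm
  rw [← sum_subset (range_subset_range.2 h)]
  · refine sum_congr rfl fun j hj => ?_
    rw [mem_range] at hj
    congr 1; omega
  · intro j _ hj
    rw [mem_range] at hj
    rw [show L - j = 0 by omega, hφ]

lemma sum_tri {L n : ℕ} (hL : L ≤ n) (hn : 1 ≤ n) :
    ∑ k ∈ Ioo (-(n : ℤ)) n, tri L k = (L : ℝ) ^ 2 := by
  obtain ⟨M, rfl⟩ : ∃ M, n = M + 1 := ⟨n - 1, by omega⟩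
  have := sum_Ioo_natAbs (fun j => ((L - j : ℕ) : ℝ)) M
  rw [sum_range_tsub (fun j => (j : ℝ)) (by simp) hL] at this
  simp only [tri]
  push_cast at this ⊢
  rw [this]
  have h : ∀ L : ℕ, ∑ j ∈ range L, ((j : ℝ) + 1) = L * (L + 1) / 2 := by
    intro L
    induction L with
    | zero => simp
    | succ L ih => rw [sum_range_succ, ih]; push_cast; ring
  rw [h]; simp; ring

lemma sum_tri_sq {L n : ℕ} (hL : L ≤ n) (hn : 1 ≤ n) :
    ∑ k ∈ Ioo (-(n : ℤ)) n, tri L k ^ 2 = (L : ℝ) * (2 * (L : ℝ) ^ 2 + 1) / 3 := by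
  obtain ⟨M, rfl⟩ : ∃ M, n = M + 1 := ⟨n - 1, by omega⟩
  have := sum_Ioo_natAbs (fun j => ((L - j : ℕ) : ℝ) ^ 2) M
  rw [sum_range_tsub (fun j => (j : ℝ) ^ 2) (by simp) hL] at this
  simp only [tri]
  push_cast at this ⊢
  rw [this]
  have h : ∀ L : ℕ, ∑ j ∈ range L, ((j : ℝ) + 1) ^ 2 = (L : ℝ) * (L + 1) * (2 * L + 1) / 6 := by
    intro L
    induction L with
    | zero => simp
    | succ L ih => rw [sum_range_succ, ih]; push_cast; ring
  rw [h]; simp; ring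

lemma sum_mul_sumCount {S T : Finset ℤ} (φ : ℤ → ℝ)
    (h : ∀ p ∈ S, ∀ q ∈ S, p + q ∈ T) :
    ∑ m ∈ T, (sumCount S m : ℝ) * φ m = ∑ p ∈ S, ∑ q ∈ S, φ (p + q) := by
  rw [← sum_product' S S fun p q => φ (p + q),
    ← sum_fiberwise_of_maps_to (t := T) (g := fun x : ℤ × ℤ => x.1 + x.2)]
  · refine sum_congr rfl fun m _ => ?_
    rw [sum_congr rfl (g := fun _ => φ m), sum_const, nsmul_eq_mul, sumCount]
    intro x hx
    rw [(mem_filter.1 hx).2]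
  · intro x hx
    exact h _ (mem_product.1 hx).1 _ (mem_product.1 hx).2

lemma sum_mul_diffCount {S T : Finset ℤ} (φ : ℤ → ℝ)
    (h : ∀ p ∈ S, ∀ q ∈ S, p - q ∈ T) :
    ∑ k ∈ T, (diffCount S k : ℝ) * φ k = ∑ p ∈ S, ∑ q ∈ S, φ (p - q) := by
  rw [← sum_product' S S fun p q => φ (p - q),
    ← sum_fiberwise_of_maps_to (t := T) (g := fun x : ℤ × ℤ => x.1 - x.2)]
  · refine sum_congr rfl fun m _ => ?_
    rw [sum_congr rfl (g := fun _ => φ m), sum_const, nsmul_eq_mul, diffCount]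
    intro x hx
    rw [(mem_filter.1 hx).2]
  · intro x hx
    exact h _ (mem_product.1 hx).1 _ (mem_product.1 hx).2

lemma sumCount_eq_sum (S : Finset ℤ) (m : ℤ) :
    (sumCount S m : ℝ) = ∑ p ∈ S, ∑ q ∈ S, if p + q = m then 1 else 0 := by
  rw [← sum_product' S S fun p q => if p + q = m then (1 : ℝ) else 0, sumCount, card_filter]
  push_cast; rfl

lemma diffCount_eq_sum (S : Finset ℤ) (k : ℤ) :
    (diffCount S k : ℝ) = ∑ p ∈ S, ∑ q ∈ S, if p - q = k then 1 else 0 := by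
  rw [← sum_product' S S fun p q => if p - q = k then (1 : ℝ) else 0, diffCount, card_filter]
  push_cast; rfl

/-- Both sides are the additive energy of `S`. -/
lemma sum_diffCount_eq_sum_sumCount (S : Finset ℤ) :
    ∑ p ∈ S, ∑ q ∈ S, (diffCount S (p - q) : ℝ) = ∑ p ∈ S, ∑ q ∈ S, (sumCount S (p + q) : ℝ) := by
  simp only [sumCount_eq_sum, diffCount_eq_sum]
  refine sum_congr rfl fun p _ => ?_
  -- Both sides count quadruples, because `p' - q' = p - q` exactly when `p' + q = p + q'`.
  rw [sum_comm, sum_comm (s := S) (t := S)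
    (f := fun q p' => ∑ q' ∈ S, if p' + q' = p + q then (1 : ℝ) else 0)]
  refine sum_congr rfl fun p' _ => ?_
  rw [sum_comm]
  refine sum_congr rfl fun q _ => sum_congr rfl fun q' _ => ?_
  congr 1
  exact propext ⟨fun h => by omega, fun h => by omega⟩

lemma diffCount_zero (S : Finset ℤ) : diffCount S 0 = #S := by
  have : ({p ∈ S ×ˢ S | p.1 - p.2 = 0} : Finset (ℤ × ℤ)) = S.diag := by
    ext ⟨a, b⟩
    simp only [mem_filter, mem_product, mem_diag]
    constructor
    · rintro ⟨⟨h, _⟩, h'⟩; exact ⟨h, by omega⟩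
    · rintro ⟨h, rfl⟩; exact ⟨⟨h, h⟩, by omega⟩
  rw [diffCount, this, diag_card]

lemma sumCount_le {g : ℕ} {S : Finset ℤ} (h : IsBStar g (S : Set ℤ)) (m : ℤ) :
    sumCount S m ≤ g := by
  have := h m
  rw [show {p : ℤ × ℤ | p.1 ∈ (S : Set ℤ) ∧ p.2 ∈ (S : Set ℤ) ∧ p.1 + p.2 = m}
      = (({p ∈ S ×ˢ S | p.1 + p.2 = m} : Finset (ℤ × ℤ)) : Set (ℤ × ℤ)) by
    ext; simp [and_assoc], Set.encard_coe_eq_coe_finsetCard] at this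
  exact_mod_cast this

/-- Swapping the two summands is an involution whose fixed points would be pairs `(s, s)`. -/
lemma even_sumCount {S : Finset ℤ} {m : ℤ} (h : ∀ s ∈ S, s + s ≠ m) : Even (sumCount S m) := by
  have : (sumCount S m : ZMod 2) = 0 := by
    rw [sumCount, card_eq_sum_ones]
    push_cast
    refine sum_involution (fun p _ => (p.2, p.1)) ?_ ?_ ?_ ?_
    · intros; decide
    · rintro ⟨a, b⟩ hp _ he
      simp only [mem_filter, mem_product, Prod.mk.injEq] at hp he
      obtain ⟨rfl, _⟩ := he
      exact h _ hp.1.1 hp.2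
    · rintro ⟨a, b⟩ hp
      simp only [mem_filter, mem_product] at hp ⊢
      exact ⟨⟨hp.1.2, hp.1.1⟩, by omega⟩
    · intros; rfl
  exact (ZMod.natCast_eq_zero_iff_even).1 this

/-! ### Window counts and the Cauchy inequality. -/

/-- The number of elements of `S` in the window of length `L` starting at `x`. -/
def window (S : Finset ℤ) (L : ℕ) (x : ℤ) : ℝ := ∑ s ∈ S, if x ≤ s ∧ s < x + L then 1 else 0

/-- Only `p` must lie in `{1, …, n}`: every window containing `p` then starts in the range of
summation. The freedom in `q` is what lets reflected points be used. -/
lemma sum_window_pair {L n : ℕ} {p : ℤ} (hp : p ∈ Icc (1 : ℤ) n) (q : ℤ) :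
    ∑ x ∈ Icc (2 - (L : ℤ)) n, ((if x ≤ p ∧ p < x + L then (1 : ℝ) else 0) *
      if x ≤ q ∧ q < x + L then 1 else 0) = tri L (p - q) := by
  rw [mem_Icc] at hp
  simp only [← ite_and, mul_ite, mul_one, mul_zero]
  rw [sum_boole, tri]
  congr 1
  have : ({x ∈ Icc (2 - (L : ℤ)) n | (x ≤ q ∧ q < x + L) ∧ x ≤ p ∧ p < x + L} : Finset ℤ)
      = Icc (max p q - L + 1) (min p q) := by
    ext x; simp only [mem_filter, mem_Icc]; omega
  rw [this, Int.card_Icc]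
  omega

lemma sum_window {S : Finset ℤ} {L n : ℕ} (hS : S ⊆ Icc (1 : ℤ) n) :
    ∑ x ∈ Icc (2 - (L : ℤ)) n, window S L x = #S * L := by
  simp only [window]
  rw [sum_comm, sum_congr rfl (g := fun _ => (L : ℝ)), sum_const, nsmul_eq_mul]
  intro p hp
  have := sum_window_pair (L := L) (hS hp) p
  rw [sub_self, tri_zero] at this
  rw [← this]
  refine sum_congr rfl fun x _ => ?_
  split_ifs <;> simp

lemma sum_window_sq {S : Finset ℤ} {L n : ℕ} (hS : S ⊆ Icc (1 : ℤ) n) :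
    ∑ x ∈ Icc (2 - (L : ℤ)) n, window S L x ^ 2 = ∑ p ∈ S, ∑ q ∈ S, tri L (p - q) := by
  simp only [window, sq, sum_mul_sum]
  rw [sum_comm]
  refine sum_congr rfl fun p hp => ?_
  rw [sum_comm]
  exact sum_congr rfl fun q _ => sum_window_pair (hS hp) q

/-- The reflected window contains `q` exactly when the original contains `n + 1 - q`, which turns
differences into sums. -/
lemma sum_window_mul_reflect {S : Finset ℤ} {L n : ℕ} (hS : S ⊆ Icc (1 : ℤ) n) :
    ∑ x ∈ Icc (2 - (L : ℤ)) n, window S L x * window S L (n + 2 - L - x)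
      = ∑ p ∈ S, ∑ q ∈ S, tri L (p + q - (n + 1)) := by
  simp only [window, sum_mul_sum]
  rw [sum_comm]
  refine sum_congr rfl fun p hp => ?_
  rw [sum_comm]
  refine sum_congr rfl fun q _ => ?_
  rw [show p + q - ((n : ℤ) + 1) = p - (n + 1 - q) by ring, ← sum_window_pair (hS hp)]
  refine sum_congr rfl fun x _ => ?_
  congr 1
  refine if_congr ?_ rfl rfl
  omega

lemma sum_reflect (φ : ℤ → ℝ) (L n : ℕ) :
    ∑ x ∈ Icc (2 - (L : ℤ)) n, φ (n + 2 - L - x) = ∑ x ∈ Icc (2 - (L : ℤ)) n, φ x := by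
  refine sum_nbij' (fun x => n + 2 - L - x) (fun x => n + 2 - L - x) ?_ ?_ ?_ ?_ ?_
  · intro x; simp only [mem_Icc]; omega
  · intro x; simp only [mem_Icc]; omega
  · intro x _; ring
  · intro x _; ring
  · intro x _; rfl

/-- Cauchy's inequality for the symmetrised window counts. -/
lemma sq_le_sum_tri {S : Finset ℤ} {L n : ℕ} (hS : S ⊆ Icc (1 : ℤ) n) (hL : 1 ≤ L) :
    2 * ((#S : ℝ) * L) ^ 2 ≤ ((n : ℝ) + L - 1) *
      (∑ p ∈ S, ∑ q ∈ S, tri L (p - q) + ∑ p ∈ S, ∑ q ∈ S, tri L (p + q - (n + 1))) := by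
  have hc := sq_sum_le_card_mul_sum_sq (s := Icc (2 - (L : ℤ)) n)
    (f := fun x => window S L x + window S L (n + 2 - L - x))
  have hcard : (#(Icc (2 - (L : ℤ)) n) : ℝ) = n + L - 1 := by
    rw [Int.card_Icc, show ((n : ℤ) + 1 - (2 - L)).toNat = n + L - 1 by omega,
      Nat.cast_sub (by omega)]
    push_cast; ring
  have hsq : ∑ x ∈ Icc (2 - (L : ℤ)) n, (window S L x + window S L (n + 2 - L - x)) ^ 2
      = 2 * (∑ p ∈ S, ∑ q ∈ S, tri L (p - q) + ∑ p ∈ S, ∑ q ∈ S, tri L (p + q - (n + 1))) := by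
    simp only [add_sq, sum_add_distrib]
    rw [sum_reflect fun x => window S L x ^ 2, sum_window_sq hS]
    simp only [mul_assoc]
    rw [← mul_sum, sum_window_mul_reflect hS]
    ring
  rw [hsq, hcard, sum_add_distrib, sum_reflect (window S L), sum_window hS] at hc
  linarith

lemma sum_tri_sum_le {g L n : ℕ} {S : Finset ℤ} (hS : S ⊆ Icc (1 : ℤ) n)
    (hg : IsBStar g (S : Set ℤ)) (hL : L ≤ n) (hn : 1 ≤ n) :
    ∑ p ∈ S, ∑ q ∈ S, tri L (p + q - (n + 1)) ≤ g * (L : ℝ) ^ 2 := by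
  have hT : ∀ p ∈ S, ∀ q ∈ S, p + q ∈ (Ioo (-(n : ℤ)) n).map (addRightEmbedding ((n : ℤ) + 1)) := by
    intro p hp q hq
    have h1 := mem_Icc.1 (hS hp)
    have h2 := mem_Icc.1 (hS hq)
    refine mem_map.2 ⟨p + q - (n + 1), mem_Ioo.2 (by omega), ?_⟩
    simp
  rw [← sum_mul_sumCount (fun m => tri L (m - (n + 1))) hT, sum_map, ← sum_tri hL hn, mul_sum]
  refine sum_le_sum fun k _ => ?_
  simp only [addRightEmbedding_apply, add_sub_cancel_right]
  exact mul_le_mul_of_nonneg_right (by exact_mod_cast sumCount_le hg _) (tri_nonneg _ _)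

/-! ### Upper bounds for the energy and the main inequality. -/

lemma energy_le {g : ℕ} {S : Finset ℤ} (hg : IsBStar g (S : Set ℤ)) :
    ∑ p ∈ S, ∑ q ∈ S, (sumCount S (p + q) : ℝ) ≤ g * (#S : ℝ) ^ 2 := by
  have : ∑ p ∈ S, ∑ q ∈ S, (sumCount S (p + q) : ℝ) ≤ ∑ p ∈ S, ∑ q ∈ S, (g : ℝ) :=
    sum_le_sum fun p _ => sum_le_sum fun q _ => by exact_mod_cast sumCount_le hg _
  simp only [sum_const, nsmul_eq_mul] at this
  linarith

/-- By parity, only sums of the form `s + s` can attain the odd value `g`. The excess over `g - 1`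
is thus at most the sum of `sumCount S (s + s)` over `S`. -/
lemma energy_le_of_odd {g : ℕ} {S : Finset ℤ} (hg : IsBStar g (S : Set ℤ)) (ho : Odd g) :
    ∑ p ∈ S, ∑ q ∈ S, (sumCount S (p + q) : ℝ) ≤ (g - 1) * (#S : ℝ) ^ 2 + g * #S := by
  have h1 : ∀ m, (sumCount S m : ℝ) ≤ (g - 1) + ∑ s ∈ S, if s + s = m then 1 else 0 := by
    intro m
    by_cases h : ∃ s ∈ S, s + s = m
    · obtain ⟨s, hs, hm⟩ := h
      have hle : (sumCount S m : ℝ) ≤ g := by exact_mod_cast sumCount_le hg m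
      have : (if s + s = m then (1 : ℝ) else 0) ≤ ∑ s ∈ S, if s + s = m then 1 else 0 :=
        single_le_sum (f := fun s => if s + s = m then (1 : ℝ) else 0)
          (fun i _ => by positivity) hs
      rw [if_pos hm] at this
      linarith
    · push Not at h
      have he := even_sumCount h
      have hle := sumCount_le hg m
      have hlt : sumCount S m + 1 ≤ g := by
        rcases hle.lt_or_eq with hlt | heq
        · exact hlt
        · rw [heq] at he
          exact absurd he (Nat.not_even_iff_odd.2 ho)
      have hlt' : (sumCount S m : ℝ) + 1 ≤ g := by exact_mod_cast hlt
      have : 0 ≤ ∑ s ∈ S, if s + s = m then (1 : ℝ) else 0 :=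
        sum_nonneg fun i _ => by positivity
      linarith
  have h2 : ∑ p ∈ S, ∑ q ∈ S, (sumCount S (p + q) : ℝ)
      ≤ ∑ p ∈ S, ∑ q ∈ S, ((g - 1 : ℝ) + ∑ s ∈ S, if s + s = p + q then 1 else 0) :=
    sum_le_sum fun p _ => sum_le_sum fun q _ => h1 _
  have h3 : ∑ p ∈ S, ∑ q ∈ S, ∑ s ∈ S, (if s + s = p + q then (1 : ℝ) else 0)
      = ∑ s ∈ S, (sumCount S (s + s) : ℝ) := by
    simp only [sumCount_eq_sum]
    rw [sum_comm' (s := S) (t' := S) (t := fun _ => S) (s' := fun _ => S) (by simp)]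
    rw [sum_congr rfl fun q _ => sum_comm, sum_comm]
    refine sum_congr rfl fun s _ => ?_
    rw [sum_comm]
    exact sum_congr rfl fun p _ => sum_congr rfl fun q _ => if_congr eq_comm rfl rfl
  have h4 : ∑ s ∈ S, (sumCount S (s + s) : ℝ) ≤ ∑ s ∈ S, (g : ℝ) :=
    sum_le_sum fun s _ => by exact_mod_cast sumCount_le hg _
  simp only [sum_add_distrib, h3, sum_const, nsmul_eq_mul] at h2 h4
  linarith

/-- The square on the left is the contribution of the difference `0` to
`∑ k, (diffCount S k - a - b * tri L k) ^ 2`. -/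
lemma sq_add_le_energy {g L n : ℕ} {S : Finset ℤ} (hS : S ⊆ Icc (1 : ℤ) n)
    (hg : IsBStar g (S : Set ℤ)) (hL1 : 1 ≤ L) (hL : L ≤ n) {E a b : ℝ} (hb : 0 ≤ b)
    (hE : ∑ p ∈ S, ∑ q ∈ S, (sumCount S (p + q) : ℝ) ≤ E) :
    ((#S : ℝ) - a - b * L) ^ 2
      + 2 * b * (2 * ((#S : ℝ) * L) ^ 2 / (n + L - 1) - g * (L : ℝ) ^ 2) + 2 * a * (#S : ℝ) ^ 2
      ≤ E + a ^ 2 * (2 * n - 1) + b ^ 2 * (L * (2 * (L : ℝ) ^ 2 + 1) / 3)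
        + 2 * a * b * (L : ℝ) ^ 2 := by
  have hn : 1 ≤ n := hL1.trans hL
  have hT : ∀ p ∈ S, ∀ q ∈ S, p - q ∈ Ioo (-(n : ℤ)) n := by
    intro p hp q hq
    have h1 := mem_Icc.1 (hS hp)
    have h2 := mem_Icc.1 (hS hq)
    exact mem_Ioo.2 (by omega)
  have hY : 2 * ((#S : ℝ) * L) ^ 2 / (n + L - 1) - g * (L : ℝ) ^ 2
      ≤ ∑ p ∈ S, ∑ q ∈ S, tri L (p - q) := by
    have hpos : (0 : ℝ) < n + L - 1 := by
      have : (1 : ℝ) ≤ n := by exact_mod_cast hn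
      have : (1 : ℝ) ≤ L := by exact_mod_cast hL1
      linarith
    have := (div_le_iff₀' hpos).2 (sq_le_sum_tri hS hL1)
    linarith [sum_tri_sum_le hS hg hL hn]
  have h0 : ((#S : ℝ) - a - b * L) ^ 2
      ≤ ∑ k ∈ Ioo (-(n : ℤ)) n, ((diffCount S k : ℝ) - a - b * tri L k) ^ 2 := by
    have := single_le_sum (s := Ioo (-(n : ℤ)) n) (a := 0)
      (f := fun k => ((diffCount S k : ℝ) - a - b * tri L k) ^ 2)
      (fun i _ => sq_nonneg _) (mem_Ioo.2 (by omega))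
    simpa only [diffCount_zero, tri_zero] using this
  have hcard : (#(Ioo (-(n : ℤ)) n) : ℝ) = 2 * n - 1 := by
    rw [Int.card_Ioo, show ((n : ℤ) - -n - 1).toNat = 2 * n - 1 by omega, Nat.cast_sub (by omega)]
    push_cast; ring
  have e1 := sum_mul_diffCount (S := S) (fun k => (diffCount S k : ℝ)) hT
  have e2 := sum_mul_diffCount (S := S) (fun _ => (1 : ℝ)) hT
  have e3 := sum_mul_diffCount (S := S) (tri L) hT
  simp only [mul_one, sum_const, nsmul_eq_mul] at e2
  rw [sum_diffCount_eq_sum_sumCount] at e1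
  have hexp : ∑ k ∈ Ioo (-(n : ℤ)) n, ((diffCount S k : ℝ) - a - b * tri L k) ^ 2
      = ∑ p ∈ S, ∑ q ∈ S, (sumCount S (p + q) : ℝ) - 2 * a * (#S : ℝ) ^ 2
        - 2 * b * ∑ p ∈ S, ∑ q ∈ S, tri L (p - q) + a ^ 2 * (2 * n - 1)
        + 2 * a * b * (L : ℝ) ^ 2 + b ^ 2 * (L * (2 * (L : ℝ) ^ 2 + 1) / 3) := by
    have : ∀ k, ((diffCount S k : ℝ) - a - b * tri L k) ^ 2
        = (diffCount S k : ℝ) * diffCount S k + (-(2 * a)) * (diffCount S k : ℝ)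
          + (-(2 * b)) * ((diffCount S k : ℝ) * tri L k) + a ^ 2 + 2 * a * b * tri L k
          + b ^ 2 * tri L k ^ 2 := fun k => by ring
    simp only [this, sum_add_distrib, ← mul_sum, e1, e2, e3, sum_tri hL hn, sum_tri_sq hL hn,
      sum_const, nsmul_eq_mul, hcard]
    ring
  rw [hexp] at h0
  nlinarith [mul_le_mul_of_nonneg_left hY hb]

/-! ### A bound for dense sets, and extremal sets. -/

/-- Dense sets have many representations of `n + 1`. -/
lemma two_mul_card_le {g n : ℕ} {S : Finset ℤ} (hS : S ⊆ Icc (1 : ℤ) n)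
    (hg : IsBStar g (S : Set ℤ)) : 2 * #S ≤ n + g := by
  have h := sumCount_le hg ((n : ℤ) + 1)
  set S' := S.image fun s => (n : ℤ) + 1 - s with hS'
  have hc : #S' = #S := card_image_of_injective _ fun x y h => by simpa using h
  have hS'n : S' ⊆ Icc (1 : ℤ) n := by
    intro x hx
    obtain ⟨s, hs, rfl⟩ := mem_image.1 hx
    have := mem_Icc.1 (hS hs)
    exact mem_Icc.2 (by omega)
  have hu : #(S ∪ S') ≤ n := by
    simpa using card_le_card (union_subset hS hS'n)
  have hi : #(S ∩ S') ≤ sumCount S ((n : ℤ) + 1) := by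
    refine card_le_card_of_injOn (fun x => (x, (n : ℤ) + 1 - x)) ?_ ?_
    · intro x hx
      obtain ⟨h1, h2⟩ := mem_inter.1 hx
      obtain ⟨s, hs, rfl⟩ := mem_image.1 h2
      simp only [coe_filter, mem_product, Set.mem_ofPred_eq]
      exact ⟨⟨h1, by simpa using hs⟩, by ring⟩
    · intro x _ y _ h
      exact (Prod.mk.inj h).1
  have := card_union_add_card_inter S S'
  omega

lemma exists_card_eq_R (g n : ℕ) :
    ∃ S : Finset ℤ, S ⊆ Icc (1 : ℤ) n ∧ IsBStar g (S : Set ℤ) ∧ #S = R g n := by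
  classical
  obtain ⟨S, hS, h⟩ := exists_mem_eq_sup
    ((Icc (1 : ℤ) (n : ℤ)).powerset.filter fun S : Finset ℤ => IsBStar g (S : Set ℤ))
    ⟨∅, by simp [IsBStar]⟩ card
  rw [mem_filter, mem_powerset] at hS
  refine ⟨S, hS.1, hS.2, ?_⟩
  rw [← h, R]

lemma card_le_of_subset_Icc {n : ℕ} {S : Finset ℤ} (hS : S ⊆ Icc (1 : ℤ) n) : #S ≤ n := by
  simpa using card_le_card hS

/-! ### The main inequality with explicit parameters. -/

/-- The energy inequality with kernel width `⌈n / 5⌉` and near-optimal weights. -/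
lemma exists_sq_add_card_pow_four_le {g n : ℕ} {S : Finset ℤ} (hS : S ⊆ Icc (1 : ℤ) n)
    (hg : IsBStar g (S : Set ℤ)) (hn : 11 ≤ n) {E : ℝ}
    (hE : ∑ p ∈ S, ∑ q ∈ S, (sumCount S (p + q) : ℝ) ≤ E) :
    ∃ c : ℝ, c ≤ 7 / 5 * (#S : ℝ) ^ 2 / n ∧
      ((#S : ℝ) - c) ^ 2 + 64 / 75 * ((#S : ℝ) ^ 4 / n) ≤ E + 2 / 5 * g * (#S : ℝ) ^ 2 := by
  obtain ⟨L, h1, h2⟩ : ∃ L : ℕ, n ≤ 5 * L ∧ 5 * L ≤ n + 4 := ⟨(n + 4) / 5, by omega, by omega⟩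
  have hL3 : 3 ≤ L := by omega
  have hn0 : (11 : ℝ) ≤ n := by exact_mod_cast hn
  have hL0 : (3 : ℝ) ≤ L := by exact_mod_cast hL3
  have h1' : (n : ℝ) ≤ 5 * L := by exact_mod_cast h1
  have h2' : 5 * (L : ℝ) ≤ n + 4 := by exact_mod_cast h2
  -- With these weights the coefficients of `N ^ 4 / n` combine to `2/3 + 4/5 - 2/15 - 8/25 - 4/25 =
  -- 64/75`.
  have hcore := sq_add_le_energy (a := 2 * (#S : ℝ) ^ 2 / (5 * n)) (b := (#S : ℝ) ^ 2 / (5 * L ^ 2))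
    (L := L) hS hg (by omega) (by omega) (by positivity) hE
  set N : ℝ := (#S : ℝ)
  set x : ℝ := (n : ℝ)
  set l : ℝ := (L : ℝ)
  have hx : 0 < x := by linarith
  have hl : 0 < l := by linarith
  have hd : 0 < x + l - 1 := by linarith
  have hN4 : 0 ≤ N ^ 4 := by positivity
  refine ⟨2 * N ^ 2 / (5 * x) + N ^ 2 / (5 * l ^ 2) * l, ?_, ?_⟩
  · have e : 2 * N ^ 2 / (5 * x) + N ^ 2 / (5 * l ^ 2) * l
        = 2 / 5 * (N ^ 2 / x) + N ^ 2 / (5 * l) := by field_simp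
    have : N ^ 2 / (5 * l) ≤ N ^ 2 / x := div_le_div_of_nonneg_left (by positivity) hx h1'
    rw [e, mul_div_assoc]
    linarith
  -- The `-1` in `n + L - 1` absorbs the rounding of `L`: it keeps `n + L - 1 ≤ 6 * n / 5`.
  · have t1 : 2 / 3 * (N ^ 4 / x) ≤ 2 * (N ^ 2 / (5 * l ^ 2)) * (2 * (N * l) ^ 2 / (x + l - 1)) := by
      have e : 2 * (N ^ 2 / (5 * l ^ 2)) * (2 * (N * l) ^ 2 / (x + l - 1))
          = N ^ 4 * (4 / (5 * (x + l - 1))) := by field_simp; ring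
      have e' : 2 / 3 * (N ^ 4 / x) = N ^ 4 * (2 / (3 * x)) := by field_simp
      rw [e, e']
      refine mul_le_mul_of_nonneg_left ?_ hN4
      rw [div_le_div_iff₀ (by positivity) (by positivity)]
      linarith
    -- The error `4/25 * (N ^ 4 / n ^ 2)` cancels against the `-1` of `2 * n - 1` in `t3`. Bounding
    -- it this way needs `L ≥ 3`, hence `n ≥ 11`.
    have t2 : (N ^ 2 / (5 * l ^ 2)) ^ 2 * (l * (2 * l ^ 2 + 1) / 3)
        ≤ 2 / 15 * (N ^ 4 / x) + 4 / 25 * (N ^ 4 / x ^ 2) := by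
      have e : (N ^ 2 / (5 * l ^ 2)) ^ 2 * (l * (2 * l ^ 2 + 1) / 3)
          = N ^ 4 * (2 / (75 * l) + 1 / (75 * l ^ 3)) := by field_simp; ring
      have e' : 2 / 15 * (N ^ 4 / x) + 4 / 25 * (N ^ 4 / x ^ 2)
          = N ^ 4 * (2 / (15 * x) + 4 / (25 * x ^ 2)) := by field_simp
      rw [e, e']
      refine mul_le_mul_of_nonneg_left (add_le_add ?_ ?_) hN4
      · rw [div_le_div_iff₀ (by positivity) (by positivity)]
        linarith
      · rw [div_le_div_iff₀ (by positivity) (by positivity)]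
        have i1 : x ^ 2 ≤ (5 * l) ^ 2 := by gcongr
        have i2 : 3 * l ^ 2 ≤ l ^ 3 := by nlinarith [sq_nonneg l]
        nlinarith
    have t3 : (2 * N ^ 2 / (5 * x)) ^ 2 * (2 * x - 1)
        = 8 / 25 * (N ^ 4 / x) - 4 / 25 * (N ^ 4 / x ^ 2) := by field_simp; ring
    have t4 : 2 * (2 * N ^ 2 / (5 * x)) * (N ^ 2 / (5 * l ^ 2)) * l ^ 2 = 4 / 25 * (N ^ 4 / x) := by
      field_simp; ring
    have t5 : 2 * (2 * N ^ 2 / (5 * x)) * N ^ 2 = 4 / 5 * (N ^ 4 / x) := by field_simp; ring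
    have t6 : 2 * (N ^ 2 / (5 * l ^ 2)) * (g * l ^ 2) = 2 / 5 * g * N ^ 2 := by field_simp
    rw [mul_sub, t6, t3, t4, t5, sub_sub] at hcore
    linarith

lemma card_pow_four_le {g n : ℕ} {S : Finset ℤ} (hS : S ⊆ Icc (1 : ℤ) n)
    (hg : IsBStar g (S : Set ℤ)) (hn : 11 ≤ n) {E : ℝ}
    (hE : ∑ p ∈ S, ∑ q ∈ S, (sumCount S (p + q) : ℝ) ≤ E) :
    64 / 75 * (#S : ℝ) ^ 4 ≤ (E + 2 / 5 * g * (#S : ℝ) ^ 2) * n := by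
  obtain ⟨c, _, hc⟩ := exists_sq_add_card_pow_four_le hS hg hn hE
  have hn0 : (0 : ℝ) < n := by exact_mod_cast (by omega : 0 < n)
  rw [← div_le_iff₀ hn0, mul_div_assoc]
  linarith [sq_nonneg ((#S : ℝ) - c)]

/-- Keeping `N ^ 2 - 2 * N * c` from the square saves `N ^ 2` of energy at the cost of a lower-order
cubic term. This saving improves the `1 / g` term of the upper limit. -/
lemma card_pow_four_add_le {g n : ℕ} {S : Finset ℤ} (hS : S ⊆ Icc (1 : ℤ) n)
    (hg : IsBStar g (S : Set ℤ)) (hn : 11 ≤ n) {E : ℝ}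
    (hE : ∑ p ∈ S, ∑ q ∈ S, (sumCount S (p + q) : ℝ) ≤ E) :
    64 / 75 * (#S : ℝ) ^ 4
      ≤ (E + (2 / 5 * g - 1) * (#S : ℝ) ^ 2) * n + 14 / 5 * (#S : ℝ) ^ 3 := by
  obtain ⟨c, hc1, hc⟩ := exists_sq_add_card_pow_four_le hS hg hn hE
  have hn0 : (0 : ℝ) < n := by exact_mod_cast (by omega : 0 < n)
  have h1 : c * n ≤ 7 / 5 * (#S : ℝ) ^ 2 := (le_div_iff₀ hn0).1 hc1
  have h2 : (#S : ℝ) * (c * n) ≤ #S * (7 / 5 * (#S : ℝ) ^ 2) := by gcongr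
  have h3 := mul_le_mul_of_nonneg_right hc hn0.le
  have h4 : 64 / 75 * ((#S : ℝ) ^ 4 / n) * n = 64 / 75 * (#S : ℝ) ^ 4 := by field_simp
  rw [add_mul, h4] at h3
  nlinarith [mul_nonneg (sq_nonneg c) hn0.le]

/-! ### Bounds for every `n`, arbitrary `g`. -/

/-- The energy inequality with a constant comparison function. -/
lemma sq_add_le_energy_const {g n : ℕ} {S : Finset ℤ} (hS : S ⊆ Icc (1 : ℤ) n)
    (hg : IsBStar g (S : Set ℤ)) (hn : 1 ≤ n) {E : ℝ} (a : ℝ)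
    (hE : ∑ p ∈ S, ∑ q ∈ S, (sumCount S (p + q) : ℝ) ≤ E) :
    ((#S : ℝ) - a) ^ 2 + 2 * a * (#S : ℝ) ^ 2 ≤ E + a ^ 2 * (2 * n - 1) := by
  simpa using sq_add_le_energy (a := a) (b := 0) hS hg le_rfl hn le_rfl hE

lemma card_sq_le {g n : ℕ} {S : Finset ℤ} (hS : S ⊆ Icc (1 : ℤ) n)
    (hg : IsBStar g (S : Set ℤ)) (hg1 : 1 ≤ g) (hn : 1 ≤ n) :
    (#S : ℝ) ^ 2 ≤ 1.69 * (g * n) := by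
  have hE := energy_le hg
  rcases Nat.lt_or_ge n 11 with h | h
  -- Although `g` is unbounded here, for fixed `n` and `N` everything is linear in `g`.
  · have hc := sq_add_le_energy_const hS hg hn 1 hE
    have hN := card_le_of_subset_Icc hS
    have hd := two_mul_card_le hS hg
    generalize #S = N at *
    have hd' : 2 * (N : ℝ) ≤ n + g := by exact_mod_cast hd
    have hg' : (1 : ℝ) ≤ g := by exact_mod_cast hg1
    interval_cases n <;> interval_cases N <;> norm_num at hc hd' ⊢ <;> linarith
  · have h4 := card_pow_four_le hS hg h hE
    rcases (Nat.zero_le #S).eq_or_lt with h0 | h0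
    · rw [← h0]; norm_num; positivity
    · have h0' : (0 : ℝ) < (#S : ℝ) ^ 2 := by positivity
      have : 64 / 75 * (#S : ℝ) ^ 2 ≤ 7 / 5 * (g * n) := by
        refine le_of_mul_le_mul_right ?_ h0'
        linarith
      have : (0 : ℝ) ≤ g * n := by positivity
      linarith

lemma R_le {g n : ℕ} (hg : 1 ≤ g) (hn : 1 ≤ n) :
    (R g n : ℝ) ≤ 1.30036 * √((g : ℝ) * n) := by
  obtain ⟨S, hS, hB, hR⟩ := exists_card_eq_R g n
  have h := card_sq_le hS hB hg hn
  rw [hR] at h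
  have h0 : (0 : ℝ) ≤ g * n := by positivity
  refine le_of_sq_le_sq ?_ (by positivity)
  rw [mul_pow, Real.sq_sqrt h0]
  linarith

/-! ### Bounds for every `n`, odd `g`. -/

/-- A bound for `B*[3]` sets. -/
lemma sub_third_sq_le_three {n : ℕ} {S : Finset ℤ} (hS : S ⊆ Icc (1 : ℤ) n)
    (hB : IsBStar 3 (S : Set ℤ)) (hn : 1 ≤ n) :
    ((#S : ℝ) - 1 / 3) ^ 2 ≤ 1.7404 * (2 * n) := by
  -- Asymptotically `a = 1` is best. The larger weight still leaves a sufficient leading constant,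
  -- and it shrinks the linear term enough to cover all `N ≥ 6`.
  have hc := sq_add_le_energy_const hS hB hn (7 / 4) (energy_le_of_odd hB (by decide))
  have hd : 2 * (#S : ℝ) ≤ n + 3 := by exact_mod_cast two_mul_card_le hS hB
  have hn1 : (1 : ℝ) ≤ n := by exact_mod_cast hn
  push_cast at hc
  rcases Nat.lt_or_ge #S 6 with h | h
  · generalize #S = N at *
    interval_cases N <;> norm_num at hd ⊢ <;> linarith
  · have h' : (6 : ℝ) ≤ #S := by exact_mod_cast h
    nlinarith

/-- A bound for `B*[5]` sets. -/
lemma sub_third_sq_le_five {n : ℕ} {S : Finset ℤ} (hS : S ⊆ Icc (1 : ℤ) n)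
    (hB : IsBStar 5 (S : Set ℤ)) (hn : 1 ≤ n) :
    ((#S : ℝ) - 1 / 3) ^ 2 ≤ 1.7404 * (4 * n) := by
  have ho := energy_le_of_odd hB (by decide)
  have hc := sq_add_le_energy_const hS hB hn (7 / 2) ho
  have hd : 2 * (#S : ℝ) ≤ n + 5 := by exact_mod_cast two_mul_card_le hS hB
  have hNn : (#S : ℝ) ≤ n := by exact_mod_cast card_le_of_subset_Icc hS
  push_cast at hc
  rcases Nat.lt_or_ge #S 18 with h | h
  · rcases Nat.lt_or_ge #S 12 with h12 | h12
    · generalize #S = N at *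
      interval_cases N <;> push_cast at hd hNn ⊢ <;> linarith
    · by_contra! hlt
      -- Since `S ⊆ {1, …, m}`, the inequality may be refuted at one `m` per value of `N`: the
      -- largest integer that `hlt` allows for `n`.
      have key : ∀ m : ℕ, n ≤ m → 6 ≤ m →
          ((#S : ℝ) - 39 / 5) ^ 2 + 8 / 5 * (72 * (#S : ℝ) ^ 2 / (m + 5) - 180) + 6 * (#S : ℝ) ^ 2
            ≤ 4 * (#S : ℝ) ^ 2 + 5 * #S + 9 * (2 * m - 1) + 16 / 25 * 146 + 864 / 5 := by
        intro m hm h6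
        have := sq_add_le_energy (n := m) (L := 6) (a := 3) (b := 4 / 5)
          (hS.trans (Icc_subset_Icc_right (by exact_mod_cast hm))) hB (by omega) h6 (by norm_num) ho
        push_cast at this
        ring_nf at this ⊢
        linarith
      obtain ⟨m, hm, h6, hlt'⟩ : ∃ m : ℕ, n ≤ m ∧ 6 ≤ m ∧
          ¬ (((#S : ℝ) - 39 / 5) ^ 2 + 8 / 5 * (72 * (#S : ℝ) ^ 2 / (m + 5) - 180)
            + 6 * (#S : ℝ) ^ 2
            ≤ 4 * (#S : ℝ) ^ 2 + 5 * #S + 9 * (2 * m - 1) + 16 / 25 * 146 + 864 / 5) := by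
        clear key hc hd ho hNn
        generalize #S = N at *
        have hm : ∀ m : ℕ, (n : ℝ) < m + 1 → n ≤ m := fun m h => by
          have : n < m + 1 := by exact_mod_cast h
          omega
        interval_cases N
        · exact ⟨19, hm _ (by norm_num at hlt; push_cast; linarith), by norm_num, by norm_num⟩
        · exact ⟨23, hm _ (by norm_num at hlt; push_cast; linarith), by norm_num, by norm_num⟩
        · exact ⟨26, hm _ (by norm_num at hlt; push_cast; linarith), by norm_num, by norm_num⟩
        · exact ⟨30, hm _ (by norm_num at hlt; push_cast; linarith), by norm_num, by norm_num⟩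
        · exact ⟨35, hm _ (by norm_num at hlt; push_cast; linarith), by norm_num, by norm_num⟩
        · exact ⟨39, hm _ (by norm_num at hlt; push_cast; linarith), by norm_num, by norm_num⟩
      exact hlt' (key m hm h6)
  · have h' : (18 : ℝ) ≤ #S := by exact_mod_cast h
    nlinarith

lemma sub_third_sq_le {g n : ℕ} {S : Finset ℤ} (hS : S ⊆ Icc (1 : ℤ) n)
    (hB : IsBStar g (S : Set ℤ)) (hg : 7 ≤ g) (ho : Odd g) (hn : 1 ≤ n) :
    ((#S : ℝ) - 1 / 3) ^ 2 ≤ 1.7404 * (((g : ℝ) - 1) * n) := by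
  have hNn : (#S : ℝ) ≤ n := by exact_mod_cast card_le_of_subset_Icc hS
  have hg' : (7 : ℝ) ≤ g := by exact_mod_cast hg
  have hn1 : (1 : ℝ) ≤ n := by exact_mod_cast hn
  have hN0 : (0 : ℝ) ≤ #S := Nat.cast_nonneg _
  have h6 : 6 * (n : ℝ) ≤ ((g : ℝ) - 1) * n := by gcongr; linarith
  rcases Nat.lt_or_ge #S 11 with h | h
  · have h' : (#S : ℝ) ≤ 10 := by exact_mod_cast Nat.le_of_lt_succ h
    nlinarith
  · have hn11 : 11 ≤ n := h.trans (card_le_of_subset_Icc hS)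
    have h4 := card_pow_four_le hS hB hn11 (energy_le_of_odd hB ho)
    have h' : (11 : ℝ) ≤ #S := by exact_mod_cast h
    by_contra! hlt
    set N : ℝ := (#S : ℝ)
    set x : ℝ := (n : ℝ)
    -- After shifting to `u, v ≥ 0`, `h5` fails because the difference of its sides has only
    -- positive coefficients.
    obtain ⟨u, hu⟩ : ∃ u : ℝ, (g : ℝ) = u + 7 := ⟨g - 7, by ring⟩
    have hu0 : 0 ≤ u := by linarith
    obtain ⟨v, hv⟩ : ∃ v : ℝ, N = v + 11 := ⟨N - 11, by ring⟩
    have hv0 : 0 ≤ v := by linarith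
    have hN : 0 < N := by linarith
    have h3 : 64 / 75 * N ^ 3 ≤ ((7 / 5 * g - 1) * N + g) * x := by
      refine le_of_mul_le_mul_right ?_ hN
      linarith
    have hk : 0 < (7 / 5 * (g : ℝ) - 1) * N + g := by rw [hu, hv]; nlinarith [mul_nonneg hu0 hv0]
    have h5 : 1.7404 * ((g : ℝ) - 1) * (64 / 75 * N ^ 3)
        < ((7 / 5 * g - 1) * N + g) * (N - 1 / 3) ^ 2 := by
      have i1 := mul_le_mul_of_nonneg_left h3 (show (0 : ℝ) ≤ 1.7404 * ((g : ℝ) - 1) by linarith)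
      have i2 := mul_lt_mul_of_pos_left hlt hk
      linarith
    rw [hu, hv] at h5
    have p1 : 0 ≤ u * v := by positivity
    have p2 : 0 ≤ u * v ^ 2 := by positivity
    have p3 : 0 ≤ u * v ^ 3 := by positivity
    have p4 : 0 ≤ v ^ 2 := by positivity
    have p5 : 0 ≤ v ^ 3 := by positivity
    ring_nf at h5
    ring_nf at p1 p2 p3 p4 p5
    linarith

lemma R_le_of_odd {g n : ℕ} (hg : 2 ≤ g) (ho : Odd g) (hn : 1 ≤ n) :
    (R g n : ℝ) ≤ 1.31925 * √(((g : ℝ) - 1) * n) + 1 / 3 := by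
  obtain ⟨S, hS, hB, hR⟩ := exists_card_eq_R g n
  have h : ((#S : ℝ) - 1 / 3) ^ 2 ≤ 1.7404 * (((g : ℝ) - 1) * n) := by
    obtain ⟨k, rfl⟩ := ho
    rcases (by omega : k = 1 ∨ k = 2 ∨ 7 ≤ 2 * k + 1) with rfl | rfl | h7
    · have := sub_third_sq_le_three hS hB hn
      norm_num at this ⊢
      linarith
    · have := sub_third_sq_le_five hS hB hn
      norm_num at this ⊢
      linarith
    · exact sub_third_sq_le hS hB h7 ⟨k, rfl⟩ hn
  rw [hR] at h
  have h0 : (0 : ℝ) ≤ ((g : ℝ) - 1) * n := by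
    have : (2 : ℝ) ≤ g := by exact_mod_cast hg
    exact mul_nonneg (by linarith) (Nat.cast_nonneg _)
  rw [← sub_le_iff_le_add]
  refine le_of_sq_le_sq ?_ (by positivity)
  rw [mul_pow, Real.sq_sqrt h0]
  linarith

/-! ### Bounds for the upper limit. -/

/-- A bound `R g n ^ 2 ≤ A n + O(R g n)` controls the upper limit. -/
lemma rhoBar_sq_le {g : ℕ} (hg : 1 ≤ g) {A C : ℝ} (hA : 0 ≤ A) (hC : 0 ≤ C)
    (h : ∀ n : ℕ, 11 ≤ n → (R g n : ℝ) ^ 2 ≤ A * n + C * R g n) :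
    rhoBar g ^ 2 ≤ A / g := by
  have hg0 : (0 : ℝ) < g := by exact_mod_cast hg
  have hlim : Filter.Tendsto (fun n : ℕ => √(A / g) + C / √((g : ℝ) * n)) Filter.atTop
      (nhds (√(A / g) + 0)) := by
    refine tendsto_const_nhds.add (Filter.Tendsto.const_div_atTop ?_ _)
    exact Real.tendsto_sqrt_atTop.comp
      (tendsto_natCast_atTop_atTop.const_mul_atTop hg0)
  have hle : ∀ᶠ n : ℕ in Filter.atTop,
      (R g n : ℝ) / √((g : ℝ) * n) ≤ √(A / g) + C / √((g : ℝ) * n) := by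
    filter_upwards [Filter.eventually_ge_atTop 11] with n hn
    have hn0 : (0 : ℝ) < n := by exact_mod_cast (by omega : 0 < n)
    have hs : 0 < √((g : ℝ) * n) := Real.sqrt_pos.2 (by positivity)
    rw [div_le_iff₀ hs, add_mul, div_mul_cancel₀ _ hs.ne', ← Real.sqrt_mul (by positivity),
      show A / g * (g * n) = A * n by field_simp, ← sub_le_iff_le_add]
    rcases le_total (R g n : ℝ) C with hc | hc
    · exact (sub_nonpos.2 hc).trans (Real.sqrt_nonneg _)
    -- For `N ≥ C`, `(N - C) ^ 2 ≤ N ^ 2 - C * N ≤ A * n`.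
    · refine Real.le_sqrt_of_sq_le ?_
      nlinarith [h n hn]
  have hnn : ∀ n : ℕ, 0 ≤ (R g n : ℝ) / √((g : ℝ) * n) := fun n => by positivity
  have h1 : rhoBar g ≤ √(A / g) + 0 := by
    rw [← hlim.limsup_eq]
    exact Filter.limsup_le_limsup hle
      (Filter.isCoboundedUnder_le_of_le Filter.atTop hnn) hlim.isBoundedUnder_le
  have h0 : 0 ≤ rhoBar g :=
    Filter.le_limsup_of_frequently_le (Filter.Frequently.of_forall hnn)
      (hlim.isBoundedUnder_le.mono_le hle)
  rw [add_zero] at h1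
  calc rhoBar g ^ 2 ≤ √(A / g) ^ 2 := by gcongr
    _ = A / g := Real.sq_sqrt (by positivity)

lemma rhoBar_sq_le_of_two_le {g : ℕ} (hg : 2 ≤ g) :
    rhoBar g ^ 2 ≤ 1.640625 - 1.171875 / g := by
  have hg' : (2 : ℝ) ≤ g := by exact_mod_cast hg
  have := rhoBar_sq_le (g := g) (by omega) (A := 1.640625 * g - 1.171875) (C := 3.28125)
    (by linarith) (by norm_num) fun n hn => ?_
  · refine this.trans_eq ?_
    field_simp
  · obtain ⟨S, hS, hB, hR⟩ := exists_card_eq_R g n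
    have h4 := card_pow_four_add_le hS hB hn (energy_le hB)
    rw [hR] at h4
    rcases (Nat.cast_nonneg (α := ℝ) (R g n)).eq_or_lt with h0 | h0
    · rw [← h0]
      have : (0 : ℝ) ≤ (1.640625 * g - 1.171875) * n :=
        mul_nonneg (by linarith) (Nat.cast_nonneg _)
      linarith
    · refine le_of_mul_le_mul_right ?_ (pow_pos h0 2)
      linarith

lemma rhoBar_sq_le_of_odd {g : ℕ} (hg : 3 ≤ g) (ho : Odd g) :
    rhoBar g ^ 2 ≤ 1.640625 - 2.34375 / g := by
  have hg' : (3 : ℝ) ≤ g := by exact_mod_cast hg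
  have := rhoBar_sq_le (g := g) (by omega) (A := 1.640625 * g - 2.34375)
    (C := 3.28125 + 1.171875 * g) (by linarith) (by positivity) fun n hn => ?_
  · refine this.trans_eq ?_
    field_simp
  · obtain ⟨S, hS, hB, hR⟩ := exists_card_eq_R g n
    have h4 := card_pow_four_add_le hS hB hn (energy_le_of_odd hB ho)
    rw [hR] at h4
    have hN := Nat.cast_nonneg (α := ℝ) (R g n)
    generalize (R g n : ℝ) = N at *
    by_contra! hlt
    have hn0 : (0 : ℝ) ≤ n := Nat.cast_nonneg _
    have hA : (n : ℝ) ≤ (1.640625 * g - 2.34375) * n := le_mul_of_one_le_left hn0 (by linarith)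
    have hCN : 0 ≤ (3.28125 + 1.171875 * (g : ℝ)) * N := by positivity
    -- If the bound fails then `n ≤ N ^ 2`, so the extra energy term `g * N * n` is at most `g * N ^
    -- 3` and is absorbed by `C`.
    have hnN : (n : ℝ) ≤ N ^ 2 := by linarith
    have i1 : (g : ℝ) * N * n ≤ g * N * N ^ 2 := by gcongr
    have hpos : 0 < N := by
      rcases hN.eq_or_lt with h0 | h0
      · rw [← h0] at hlt
        nlinarith
      · exact h0
    have i3 := mul_lt_mul_of_pos_left hlt (pow_pos hpos 2)
    nlinarith

lemma rhoBar_three_sq_le : rhoBar 3 ^ 2 ≤ 2 / 3 := by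
  have := rhoBar_sq_le (g := 3) (by omega) (A := 2) (C := 7)
    (by norm_num) (by norm_num) fun n hn => ?_
  · exact_mod_cast this
  · obtain ⟨S, hS, hB, hR⟩ := exists_card_eq_R 3 n
    have hn0 : (11 : ℝ) ≤ n := by exact_mod_cast hn
    have h := sq_add_le_energy_const hS hB (by omega) 1 (energy_le_of_odd hB (by decide))
    rw [hR] at h
    push_cast at h
    have hN := Nat.cast_nonneg (α := ℝ) (R 3 n)
    nlinarith

end BStar

/-! ### Comparison with the stated constants. -/

theorem theorem2 :
    (∀ g n : ℕ, 1 ≤ g → 1 ≤ n →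
      (BStar.R g n : ℝ) ≤ 1.30036 * √((g : ℝ) * (n : ℝ))) ∧
    (∀ g n : ℕ, 2 ≤ g → Odd g → 1 ≤ n →
      (BStar.R g n : ℝ) ≤ 1.31925 * √(((g : ℝ) - 1) * (n : ℝ)) + 1 / 3) ∧
    (∀ g : ℕ, 2 ≤ g → g ≤ 8 → Even g →
      BStar.rhoBar g ^ 2 ≤ 1.74043 - 1.00483 / (g : ℝ)) ∧
    (∀ g : ℕ, 10 ≤ g → Even g →
      BStar.rhoBar g ^ 2 ≤ 1.58337 - 0.026335 / (g : ℝ)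
        + √(0.011572 - 0.083397 / (g : ℝ) + 0.00069356 / (g : ℝ) ^ 2)) ∧
    (∀ g : ℕ, 2 ≤ g → g ≤ 23 → Odd g →
      BStar.rhoBar g ^ 2 ≤ 1.74043 - 2.74525 / (g : ℝ)) ∧
    (∀ g : ℕ, 25 ≤ g → Odd g →
      BStar.rhoBar g ^ 2 ≤ 1.58337 - 0.071949 / (g : ℝ)
        + √(0.011572 - 0.22784 / (g : ℝ) + 0.0051768 / (g : ℝ) ^ 2)) := by
  refine ⟨fun g n hg hn => BStar.R_le hg hn,
    fun g n hg ho hn => BStar.R_le_of_odd hg ho hn, ?_, ?_, ?_, ?_⟩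
  · intro g hg _ _
    have h := BStar.rhoBar_sq_le_of_two_le hg
    have hx : (0 : ℝ) ≤ 1 / g := by positivity
    rw [div_eq_mul_one_div] at h ⊢
    linarith
  · intro g hg _
    have h := BStar.rhoBar_sq_le_of_two_le (g := g) (by omega)
    have hx : (0 : ℝ) ≤ 1 / g := by positivity
    suffices hs : 0.057255 - 1.14554 * (1 / (g : ℝ))
        ≤ √(0.011572 - 0.083397 / (g : ℝ) + 0.00069356 / (g : ℝ) ^ 2) by
      rw [div_eq_mul_one_div] at h
      rw [div_eq_mul_one_div (0.026335 : ℝ)]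
      linarith
    -- For `1 / g ≥ 1 / 20` the left side is negative.
    rcases le_total (1 / (g : ℝ)) (1 / 20) with h20 | h20
    · refine Real.le_sqrt_of_sq_le ?_
      rw [div_eq_mul_one_div 0.083397, div_eq_mul_one_div 0.00069356, ← one_div_pow]
      generalize 1 / (g : ℝ) = x at *
      nlinarith
    · exact le_trans (by linarith) (Real.sqrt_nonneg _)
  · intro g hg _ ho
    -- At `g = 3` the general odd bound gives about `0.859`, above the required `0.825`.
    rcases eq_or_ne g 3 with rfl | h3
    · refine BStar.rhoBar_three_sq_le.trans ?_
      norm_num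
    · have hg5 : 5 ≤ g := by
        obtain ⟨k, rfl⟩ := ho
        omega
      have h := BStar.rhoBar_sq_le_of_odd (by omega) ho
      have hx : 1 / (g : ℝ) ≤ 1 / 5 :=
        one_div_le_one_div_of_le (by norm_num) (by exact_mod_cast hg5)
      rw [div_eq_mul_one_div] at h ⊢
      linarith
  · intro g hg ho
    have h := BStar.rhoBar_sq_le_of_odd (g := g) (by omega) ho
    have hx : (0 : ℝ) ≤ 1 / g := by positivity
    suffices hs : 0.057255 - 2.271801 * (1 / (g : ℝ))
        ≤ √(0.011572 - 0.22784 / (g : ℝ) + 0.0051768 / (g : ℝ) ^ 2) by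
      rw [div_eq_mul_one_div] at h
      rw [div_eq_mul_one_div (0.071949 : ℝ)]
      linarith
    rcases le_total (1 / (g : ℝ)) (1 / 35) with h35 | h35
    · refine Real.le_sqrt_of_sq_le ?_
      rw [div_eq_mul_one_div 0.22784, div_eq_mul_one_div 0.0051768, ← one_div_pow]
      generalize 1 / (g : ℝ) = x at *
      nlinarith
    · exact le_trans (by linarith) (Real.sqrt_nonneg _)
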